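/- Let $n\ge 4$ and let $\mathbb{R}^n_2$ denote $\mathbb{R}^n$ with a non-degenerate symmetric bilinear form $\langle\cdot,\cdot\rangle$ of signature $(n-2,2)$. Let $\mathrm{Iso}(\mathbb{R}^n_2)$ be its group of affine isometries, whose elements are written $\gamma=(I+A,v)$, with linear part $I+A$ and translation part $v$. Let $\Gamma\subset\mathrm{Iso}(\mathbb{R}^n_2)$ be a subgroup acting freely and properly discontinuously on $\mathbb{R}^n$ such that the complete flat pseudo-Riemannian manifold $M=\mathbb{R}^n_2/\Gamma$ is homogeneous, i.e. its isometry group acts transitively on $M$. Put $U_\Gamma=\sum_{(I+A,v)\in\Gamma}\operatorname{im}A$. A Witt basis with respect to a subspace $U$ with $\dim U=k$ is a basis $u_1,\dots,u_k,w_1,\dots,w_{n-2k},u_1^*,\dots,u_k^*$ of $\mathbb{R}^n$ such that the $u_i$ span $U$, the $w_i$ span a non-degenerate subspace $W$ with $U^\perp=U\oplus W$, and $\langle u_i,u_j^*\rangle=\delta_{ij}$. Then there are finitely many elements $\gamma_i=(I+A_i,v_i)\in\Gamma$, $i=1,\dots,N$ ($N\ge 0$), such that: (1) $\gamma_1,\dots,\gamma_N$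 generate $\Gamma$, and $v_1,\dots,v_N$ are linearly independent. (2) If there exists $(I+A,v)\in\Gamma$ with $A\neq 0$, then Witt bases with respect to $U_\Gamma$ with $k=\dim U_\Gamma=2$ exist, and in every such basis, for every $i$, $$\gamma_i=(I+A_i,v_i)=\left(\begin{pmatrix} I_2&0&C_i\\0&I_{n-4}&0\\0&0&I_2\end{pmatrix},\begin{pmatrix}u_i\\w_i\\0\end{pmatrix}\right),\qquad C_i=\begin{pmatrix}0&c_i\\-c_i&0\end{pmatrix},$$ with $c_i\in\mathbb{R}$, $u_i\in\mathbb{R}^2$, $w_i\in\mathbb{R}^{n-4}$. (3) In every Witt basis with respect to $U_\Gamma$, let $w_i$ be the $W$-coordinates of $v_i$ and $C_i$ the upper right $k\times k$ block of $I+A_i$ (where $k=\dim U_\Gamma$). Then for all $\lambda_1,\dots,\lambda_N\in\mathbb{R}$, $\sum_i\lambda_iw_i=0$ implies $\sum_i\lambda_iC_i=0$; and $\sum_i\lambda_iC_i=0$ is equivalent to $\sum_i\lambda_iA_i=0$. -/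

import Mathlib

open scoped ContDiff

/-- The affine group of `V` acts on `V` by evaluation. -/
instance affineEquivMulAction {V : Type*} [AddCommGroup V] [Module ℝ V] :
    MulAction (V ≃ᵃ[ℝ] V) V where
  smul g x := g x
  one_smul _ := rfl
  mul_smul _ _ _ := rfl

section Linear

variable {V : Type*} [AddCommGroup V] [Module ℝ V]

/-- `B` is a non-degenerate symmetric bilinear form of signature `(p, q)`: it has an orthogonal
basis with `p` vectors of square `1` and `q` vectors of square `-1`. -/
def HasSignature (B : LinearMap.BilinForm ℝ V) (p q : ℕ) : Prop :=
  ∃ e : Module.Basis (Fin p ⊕ Fin q) ℝ V,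
    ∀ i j, B (e i) (e j) = if i = j then Sum.elim (fun _ => (1 : ℝ)) (fun _ => -1) i else 0

/-- The group of (affine) isometries of the pseudo-Euclidean space `(V, B)`. -/
def pseudoIso (B : LinearMap.BilinForm ℝ V) : Subgroup (V ≃ᵃ[ℝ] V) where
  carrier := {g | ∀ x y, B (g.linear x) (g.linear y) = B x y}
  one_mem' := fun _ _ => rfl
  mul_mem' := fun {g h} hg hh x y => by
    change B (g.linear (h.linear x)) (g.linear (h.linear y)) = B x y
    rw [hg, hh]
  inv_mem' := fun {g} hg x y => by
    change B (g.linear.symm x) (g.linear.symm y) = B x y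
    rw [← hg, LinearEquiv.apply_symm_apply, LinearEquiv.apply_symm_apply]

/-- For an affine map `g = (I + A, v)`, this is `A`. -/
def linA (g : V ≃ᵃ[ℝ] V) : V →ₗ[ℝ] V := (g.linear : V →ₗ[ℝ] V) - LinearMap.id

/-- For an affine map `g = (I + A, v)`, this is the translation part `v`. -/
def translationPart (g : V ≃ᵃ[ℝ] V) : V := g 0

/-- `U_Γ`, the sum of the images of `A` over all `(I + A, v) ∈ Γ`. -/
def holonomySpace (Γ : Subgroup (V ≃ᵃ[ℝ] V)) : Submodule ℝ V :=
  ⨆ g ∈ Γ, LinearMap.range (linA g)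

/-- A Witt basis `u₁, …, u_k, w₁, …, w_m, u₁*, …, u_k*` of `(V, B)` with respect to the
subspace `U`. -/
structure WittBasis (B : LinearMap.BilinForm ℝ V) (U : Submodule ℝ V) (k m : ℕ) where
  /-- The underlying basis. -/
  basis : Module.Basis (Fin k ⊕ Fin m ⊕ Fin k) ℝ V
  /-- The vectors `u_i` span `U`. -/
  span_u : Submodule.span ℝ (Set.range fun i => basis (Sum.inl i)) = U
  /-- The span `W` of the `w_i` is non-degenerate. -/
  nondegenerate_w :
    (B.restrict (Submodule.span ℝ (Set.range fun i => basis (Sum.inr (Sum.inl i))))).Nondegenerate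
  /-- `U^⊥ = U + W` (the sum is direct because `basis` is a basis). -/
  orthogonal_eq : B.orthogonal U =
    U ⊔ Submodule.span ℝ (Set.range fun i => basis (Sum.inr (Sum.inl i)))
  /-- The `u_j*` are dual to the `u_i`. -/
  dual : ∀ i j, B (basis (Sum.inl i)) (basis (Sum.inr (Sum.inr j))) = if i = j then 1 else 0

namespace WittBasis

variable {B : LinearMap.BilinForm ℝ V} {U : Submodule ℝ V} {k m : ℕ}

/-- The matrix of the linear part of `g` in the Witt basis. -/
noncomputable def linMatrix (b : WittBasis B U k m) (g : V ≃ᵃ[ℝ] V) :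
    Matrix (Fin k ⊕ Fin m ⊕ Fin k) (Fin k ⊕ Fin m ⊕ Fin k) ℝ :=
  LinearMap.toMatrix b.basis b.basis (g.linear : V →ₗ[ℝ] V)

/-- The coordinate column of the translation part of `g` in the Witt basis. -/
noncomputable def transCoord (b : WittBasis B U k m) (g : V ≃ᵃ[ℝ] V) :
    Fin k ⊕ Fin m ⊕ Fin k → ℝ :=
  b.basis.repr (translationPart g)

/-- The upper right `k × k` block `C` of the linear part of `g`
(the identity matrix does not contribute to this block). -/
noncomputable def blockC (b : WittBasis B U k m) (g : V ≃ᵃ[ℝ] V) : Matrix (Fin k) (Fin k) ℝ :=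
  Matrix.of fun i j => b.linMatrix g (Sum.inl i) (Sum.inr (Sum.inr j))

/-- The coordinates of the `W`-component `w` of the translation part of `g`. -/
noncomputable def compW (b : WittBasis B U k m) (g : V ≃ᵃ[ℝ] V) : Fin m → ℝ :=
  fun i => b.transCoord g (Sum.inr (Sum.inl i))

end WittBasis

/-- The block matrix with rows `(I_k, 0, C)`, `(0, I_m, 0)`, `(0, 0, I_k)`. -/
def upperRightBlock {k m : ℕ} (C : Matrix (Fin k) (Fin k) ℝ) :
    Matrix (Fin k ⊕ Fin m ⊕ Fin k) (Fin k ⊕ Fin m ⊕ Fin k) ℝ :=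
  Matrix.fromBlocks 1 (Matrix.fromCols 0 C) 0 (Matrix.fromBlocks 1 0 0 1)

end Linear

section Manifold

variable {V : Type*} [NormedAddCommGroup V] [NormedSpace ℝ V]

/-- A homeomorphism `f` of `M = V/Γ` is an isometry for the flat metric induced by `B` if near
every point it has a smooth local lift `F` to `V` that preserves the metric tensor `B`. -/
def IsQuotientIsometry (B : LinearMap.BilinForm ℝ V) (Γ : Subgroup (V ≃ᵃ[ℝ] V))
    (f : MulAction.orbitRel.Quotient Γ V ≃ₜ MulAction.orbitRel.Quotient Γ V) : Prop :=
  ∀ x : V, ∃ (O : Set V) (F : V → V), IsOpen O ∧ x ∈ O ∧ ContDiffOn ℝ ∞ F O ∧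
    ∀ y ∈ O, f (Quotient.mk _ y) = Quotient.mk _ (F y) ∧
      ∀ a b : V, B (fderiv ℝ F y a) (fderiv ℝ F y b) = B a b

/-- `V/Γ` is a complete flat pseudo-Riemannian homogeneous manifold: `Γ` is a group of isometries
of `(V, B)` acting freely and properly discontinuously (so that `V/Γ` is a complete flat
pseudo-Riemannian manifold covered by `V`, with fundamental group `Γ`), and the isometry group of
`V/Γ` acts transitively on `V/Γ`. -/
structure IsCompleteFlatHomogeneous (B : LinearMap.BilinForm ℝ V)
    (Γ : Subgroup (V ≃ᵃ[ℝ] V)) : Prop where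
  isometries : Γ ≤ pseudoIso B
  free : ∀ g ∈ Γ, ∀ x : V, g x = x → g = 1
  properlyDiscontinuous : ProperlyDiscontinuousSMul Γ V
  homogeneous : ∀ p q : MulAction.orbitRel.Quotient Γ V,
    ∃ f : MulAction.orbitRel.Quotient Γ V ≃ₜ MulAction.orbitRel.Quotient Γ V,
      IsQuotientIsometry B Γ f ∧ f p = q

end Manifold

/-! ### Affine maps and orbits -/

section Affine

variable {V : Type*} [AddCommGroup V] [Module ℝ V]

/-! Isometries of `V/Γ` lift to affine isometries normalizing `Γ`, so homogeneity makes the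
normalizer of `Γ` transitive on `V`. Since `Γ` is countable, transitivity has two rigid
consequences. The number `B (k₁ x - x) (k₂ x - x)` does not depend on `x` (`apply_displacement_eq`),
and a real combination of displacements `γ i x - x` that vanishes at one point vanishes everywhere
(`sum_smul_displacement_eq_zero`). Countability does the work usually done by passing to the
centralizer of `Γ`.

Comparing coefficients in the first fact shows that each `A` is skew with totally isotropic image
and that the `A`'s anticommute. With only two negative directions isotropic subspaces have dimension
at most 2, whereas a nonzero skew map has rank at least 2. So products `A₁A₂` vanish and all nonzero
`A` share the image `U_Γ`, a totally isotropic plane. Moreover each `A` kills `U_Γ^⊥` and each `v`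
lies in `U_Γ^⊥`. This is the matrix form (2). It also makes `γ ↦ v` an injective homomorphism onto a
discrete subgroup of `V`, and lifting a `ℤ`-basis of that lattice gives (1).

For (3), let `T = ∑ λ_i A_i`. If `∑ λ_i w_i = 0`, then `∑ λ_i v_i` lies in `U_Γ`. If `T ≠ 0`, its
image is all of `U_Γ`, so the combined displacement has a zero; by the second fact it vanishes
identically, forcing `T = 0`. -/

theorem affineEquiv_apply_eq (g : V ≃ᵃ[ℝ] V) (x : V) :
    g x = g.linear x + translationPart g := by
  have := g.map_vadd 0 x
  simpa [translationPart] using this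

theorem affineEquiv_apply_sub_self (g : V ≃ᵃ[ℝ] V) (x : V) :
    g x - x = linA g x + translationPart g := by
  rw [affineEquiv_apply_eq, linA]
  simp only [LinearMap.sub_apply, LinearEquiv.coe_coe, LinearMap.id_apply]
  abel

theorem affineEquiv_apply_sub_apply (g : V ≃ᵃ[ℝ] V) (x y : V) :
    g x - g y = g.linear (x - y) := by
  rw [affineEquiv_apply_eq, affineEquiv_apply_eq g y, map_sub]
  abel

theorem AffineEquiv.mul_apply_eq (g h : V ≃ᵃ[ℝ] V) (x : V) : (g * h) x = g (h x) := rfl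

theorem AffineEquiv.inv_apply_self_eq (g : V ≃ᵃ[ℝ] V) (x : V) : g⁻¹ (g x) = x :=
  g.symm_apply_apply x

theorem AffineEquiv.apply_inv_self_eq (g : V ≃ᵃ[ℝ] V) (x : V) : g (g⁻¹ x) = x :=
  g.apply_symm_apply x

theorem quotient_mk_eq_iff (Γ : Subgroup (V ≃ᵃ[ℝ] V)) (x y : V) :
    (Quotient.mk _ x : MulAction.orbitRel.Quotient Γ V) = Quotient.mk _ y ↔
      ∃ g ∈ Γ, g y = x := by
  rw [Quotient.eq]
  constructor
  · rintro ⟨g, hg⟩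
    exact ⟨g, g.2, hg⟩
  · rintro ⟨g, hg, h⟩
    exact ⟨⟨g, hg⟩, h⟩

theorem linear_injective_of_isometry {B : LinearMap.BilinForm ℝ V}
    (hnd : ∀ x, (∀ y, B x y = 0) → x = 0) (T : V →ₗ[ℝ] V)
    (hT : ∀ a b, B (T a) (T b) = B a b) : Function.Injective T := by
  rw [← LinearMap.ker_eq_bot, LinearMap.ker_eq_bot']
  intro a ha
  refine hnd a fun b => ?_
  rw [← hT, ha, map_zero, LinearMap.zero_apply]

end Affine

/-! ### Baire category for countable families of affine maps -/

section Baire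

variable {V : Type*} [NormedAddCommGroup V] [NormedSpace ℝ V]

theorem AffineMap.eq_zero_of_isOpen (h : V →ᵃ[ℝ] V) {O : Set V} (hO : IsOpen O)
    (hne : O.Nonempty) (hz : ∀ y ∈ O, h y = 0) : h = 0 :=
  AffineMap.ext_on (hO.affineSpan_eq_top hne) fun y hy => hz y hy

variable [FiniteDimensional ℝ V]

/-- The nonvanishing set of a nonzero affine map is open and dense, so by Baire countably many of
them have a common point in `O`. -/
theorem exists_affineMap_eq_zero {ι : Type*} [Countable ι] (h : ι → V →ᵃ[ℝ] V) {O : Set V}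
    (hO : IsOpen O) (hne : O.Nonempty) (hz : ∀ y ∈ O, ∃ i, h i y = 0) : ∃ i, h i = 0 := by
  by_contra! hcon
  have hcont : ∀ i, Continuous (h i) := fun i => (h i).continuous_of_finiteDimensional
  have hd : Dense (⋂ i, {y | h i y ≠ 0}) := by
    have : CompleteSpace V := FiniteDimensional.complete ℝ V
    refine dense_iInter_of_isOpen (fun i => isOpen_ne_fun (hcont i) continuous_const) fun i => ?_
    rw [dense_iff_inter_open]
    intro U hU hUne
    by_contra hemp
    refine hcon i ((h i).eq_zero_of_isOpen hU hUne fun y hy => ?_)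
    by_contra hy0
    exact hemp ⟨y, hy, hy0⟩
  obtain ⟨y, hyO, hy⟩ := hd.inter_open_nonempty O hO hne
  obtain ⟨i, hi⟩ := hz y hyO
  exact (Set.mem_iInter.1 hy i) hi

/-- Replaces an element of `Γ` chosen separately at each point by a single one. -/
theorem exists_affineEquiv_eq_mul {Γ : Subgroup (V ≃ᵃ[ℝ] V)} [Countable Γ] (g h : V ≃ᵃ[ℝ] V)
    {O : Set V} (hO : IsOpen O) (hne : O.Nonempty) (hz : ∀ y ∈ O, ∃ k ∈ Γ, k (h y) = g y) :
    ∃ k ∈ Γ, k * h = g := by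
  obtain ⟨k, hk⟩ := exists_affineMap_eq_zero
    (fun k : Γ => ((k.1 * h : V ≃ᵃ[ℝ] V) : V →ᵃ[ℝ] V) - (g : V →ᵃ[ℝ] V)) hO hne fun y hy => by
      obtain ⟨k, hk, hky⟩ := hz y hy
      exact ⟨⟨k, hk⟩, sub_eq_zero.2 hky⟩
  refine ⟨k, k.2, AffineEquiv.ext fun y => ?_⟩
  exact sub_eq_zero.1 (congrArg (fun F : V →ᵃ[ℝ] V => F y) hk)

end Baire

/-! ### Local isometries are affine, and quotient isometries lift -/

section LocalIsometry

variable {V : Type*} [NormedAddCommGroup V] [NormedSpace ℝ V] [FiniteDimensional ℝ V]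
  {B : LinearMap.BilinForm ℝ V}

/-- The uniqueness argument for the Levi-Civita connection: differentiate the isometry condition and
use the symmetry of the second derivative. -/
theorem fderiv_fderiv_eq_zero_of_isometry (hs : ∀ x y, B x y = B y x)
    (hnd : ∀ x, (∀ y, B x y = 0) → x = 0) {O : Set V} (hO : IsOpen O) {F : V → V}
    (hF : ContDiffOn ℝ ∞ F O)
    (hiso : ∀ y ∈ O, ∀ a b, B (fderiv ℝ F y a) (fderiv ℝ F y b) = B a b) {x : V} (hx : x ∈ O) :
    fderiv ℝ (fderiv ℝ F) x = 0 := by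
  have hFx : ContDiffAt ℝ ∞ F x := hF.contDiffAt (hO.mem_nhds hx)
  have hsymm : IsSymmSndFDerivAt ℝ F x := hFx.isSymmSndFDerivAt (by simpa using ENat.LEInfty.out)
  have hG : DifferentiableAt ℝ (fderiv ℝ F) x :=
    (hFx.fderiv_right (m := 1) (by norm_cast)).differentiableAt (by simp)
  set D := fderiv ℝ (fderiv ℝ F) x with hD
  have hev : ∀ a : V, HasFDerivAt (fun y => fderiv ℝ F y a) (D.flip a) x := fun a => by
    have := hG.hasFDerivAt.clm_apply (hasFDerivAt_const a x)
    simpa using this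
  let Bc : V →L[ℝ] V →L[ℝ] ℝ := LinearMap.toContinuousLinearMap
    ((LinearMap.toContinuousLinearMap : (V →ₗ[ℝ] ℝ) ≃ₗ[ℝ] (V →L[ℝ] ℝ)).toLinearMap ∘ₗ B)
  have hBc : ∀ a b, Bc a b = B a b := fun a b => rfl
  have hskew : ∀ c a b, B (D c a) (fderiv ℝ F x b) + B (fderiv ℝ F x a) (D c b) = 0 := by
    intro c a b
    have h1 : HasFDerivAt (fun y => Bc (fderiv ℝ F y a) (fderiv ℝ F y b))
        _ x := Bc.hasFDerivAt_of_bilinear (hev a) (hev b)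
    have h2 : HasFDerivAt (fun y => Bc (fderiv ℝ F y a) (fderiv ℝ F y b))
        (0 : V →L[ℝ] ℝ) x := by
      refine (hasFDerivAt_const (B a b) x).congr_of_eventuallyEq ?_
      filter_upwards [hO.mem_nhds hx] with y hy
      exact hiso y hy a b
    have h3 := congrArg (fun T : V →L[ℝ] ℝ => T c) (h1.unique h2)
    simp [hBc] at h3
    linarith
  -- A trilinear form symmetric in its first two arguments and skew in the last two is zero.
  have hT : ∀ c a b, B (D c a) (fderiv ℝ F x b) = 0 := by
    intro c a b
    have sy : ∀ p q, D p q = D q p := fun p q => hsymm p q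
    have e1 := hskew c a b
    have e2 := hskew a b c
    have e3 := hskew b c a
    rw [hs (fderiv ℝ F x _)] at e1 e2 e3
    rw [sy b c] at e3
    rw [sy b a] at e3
    rw [sy a c] at e2
    linarith
  have hsurj : Function.Surjective (fderiv ℝ F x : V →ₗ[ℝ] V) :=
    LinearMap.injective_iff_surjective.1 (linear_injective_of_isometry hnd _ (hiso x hx))
  ext c a
  refine hnd _ fun z => ?_
  obtain ⟨b, rfl⟩ := hsurj z
  exact hT c a b

theorem exists_pseudoIso_eqOn_ball (hs : ∀ x y, B x y = B y x)
    (hnd : ∀ x, (∀ y, B x y = 0) → x = 0) {O : Set V} (hO : IsOpen O) {F : V → V}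
    (hF : ContDiffOn ℝ ∞ F O)
    (hiso : ∀ y ∈ O, ∀ a b, B (fderiv ℝ F y a) (fderiv ℝ F y b) = B a b) {x : V} (hx : x ∈ O) :
    ∃ g ∈ pseudoIso B, ∃ r > 0, Metric.ball x r ⊆ O ∧ ∀ y ∈ Metric.ball x r, F y = g y := by
  obtain ⟨r, hr, hrO⟩ := Metric.isOpen_iff.1 hO x hx
  have hdiff : ∀ y ∈ Metric.ball x r, DifferentiableAt ℝ F y := fun y hy =>
    (hF.contDiffAt (hO.mem_nhds (hrO hy))).differentiableAt (by simp)
  have hpre := (convex_ball x r).isPreconnected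
  have hconst : ∀ y ∈ Metric.ball x r, fderiv ℝ F y = fderiv ℝ F x := fun y hy =>
    Metric.isOpen_ball.is_const_of_fderiv_eq_zero hpre
      (fun z hz => (((hF.contDiffAt (hO.mem_nhds (hrO hz))).fderiv_right
        (m := 1) (by norm_cast)).differentiableAt (by simp)).differentiableWithinAt)
      (fun z hz => fderiv_fderiv_eq_zero_of_isometry hs hnd hO hF hiso (hrO hz))
      hy (Metric.mem_ball_self hr)
  set T := fderiv ℝ F x with hT
  have haff : ∀ y ∈ Metric.ball x r, F y - T y = F x - T x := fun y hy =>
    Metric.isOpen_ball.is_const_of_fderiv_eq_zero (f := fun y => F y - T y) hpre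
      (fun z hz => ((hdiff z hz).sub T.differentiableAt).differentiableWithinAt)
      (fun z hz => by
        change fderiv ℝ (fun y => F y - T y) z = 0
        rw [fderiv_fun_sub (hdiff z hz) T.differentiableAt, hconst z hz,
          ContinuousLinearMap.fderiv, sub_self])
      hy (Metric.mem_ball_self hr)
  let e : V ≃ₗ[ℝ] V := LinearEquiv.ofInjectiveEndo (T : V →ₗ[ℝ] V)
    (linear_injective_of_isometry hnd _ (hiso x hx))
  refine ⟨e.toAffineEquiv.trans (AffineEquiv.constVAdd ℝ V (F x - T x)), hiso x hx, r, hr, hrO,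
    fun y hy => ?_⟩
  have : F y = (F x - T x) + T y := by rw [← haff y hy]; abel
  rw [this]
  rfl

theorem IsQuotientIsometry.exists_lift (hs : ∀ x y, B x y = B y x)
    (hnd : ∀ x, (∀ y, B x y = 0) → x = 0) {Γ : Subgroup (V ≃ᵃ[ℝ] V)} [Countable Γ]
    {f : MulAction.orbitRel.Quotient Γ V ≃ₜ MulAction.orbitRel.Quotient Γ V}
    (hf : IsQuotientIsometry B Γ f) :
    ∃ g ∈ pseudoIso B, ∀ y : V, f (Quotient.mk _ y) = Quotient.mk _ (g y) := by
  have hloc : ∀ x : V, ∃ g ∈ pseudoIso B, ∃ r > 0, ∀ y ∈ Metric.ball x r,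
      f (Quotient.mk _ y) = Quotient.mk _ (g y) := by
    intro x
    obtain ⟨O, F, hO, hx, hF, h⟩ := hf x
    obtain ⟨g, hg, r, hr, hrO, hrg⟩ :=
      exists_pseudoIso_eqOn_ball hs hnd hO hF (fun y hy => (h y hy).2) hx
    exact ⟨g, hg, r, hr, fun y hy => by rw [(h y (hrO hy)).1, hrg y hy]⟩
  obtain ⟨g, hg, r, hr, hgr⟩ := hloc 0
  refine ⟨g, hg, ?_⟩
  let S : Set V := interior {y | f (Quotient.mk _ y) = Quotient.mk _ (g y)}
  have hopen : IsOpen S := isOpen_interior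
  have hS : ∀ y ∈ S, f (Quotient.mk _ y) = Quotient.mk _ (g y) := fun y hy =>
    (interior_subset hy : y ∈ {y | f (Quotient.mk _ y) = Quotient.mk _ (g y)})
  -- On the overlap, `g` and the local lift at `x` differ by one element of `Γ`; being affine they
  -- differ by it everywhere, so agreement spreads to the whole ball around `x`.
  have hclosed : IsClosed S := by
    refine isClosed_of_closure_subset fun x hx => ?_
    obtain ⟨g', -, r', hr', hgr'⟩ := hloc x
    have hne : (Metric.ball x r' ∩ S).Nonempty :=
      mem_closure_iff.1 hx _ Metric.isOpen_ball (Metric.mem_ball_self hr')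
    obtain ⟨k, hk, hkg⟩ := exists_affineEquiv_eq_mul (Γ := Γ) g g'
      (Metric.isOpen_ball.inter hopen) hne fun y hy => by
        have h1 := hgr' y hy.1
        rw [hS y hy.2] at h1
        exact (quotient_mk_eq_iff Γ _ _).1 h1
    refine mem_interior.2 ⟨Metric.ball x r', fun y hy => ?_, Metric.isOpen_ball,
      Metric.mem_ball_self hr'⟩
    change f (Quotient.mk _ y) = Quotient.mk _ (g y)
    rw [hgr' y hy, eq_comm, quotient_mk_eq_iff]
    exact ⟨k, hk, by rw [← hkg]; rfl⟩
  have huniv : S = Set.univ := IsClopen.eq_univ ⟨hclosed, hopen⟩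
    ⟨0, mem_interior.2 ⟨Metric.ball 0 r, hgr, Metric.isOpen_ball, Metric.mem_ball_self hr⟩⟩
  exact fun y => hS y (huniv ▸ Set.mem_univ y)

end LocalIsometry

/-! ### Transitivity of the normalizer and constancy of displacements -/

section Normalizer

variable {V : Type*} [NormedAddCommGroup V] [NormedSpace ℝ V]

/-- The isometries of `(V, B)` normalizing `Γ` act transitively on `V`. -/
def IsNormalizerTransitive (B : LinearMap.BilinForm ℝ V) (Γ : Subgroup (V ≃ᵃ[ℝ] V)) : Prop :=
  ∀ p q : V, ∃ g ∈ pseudoIso B, (∀ k ∈ Γ, g * k * g⁻¹ ∈ Γ) ∧ (∀ k ∈ Γ, g⁻¹ * k * g ∈ Γ) ∧ g p = q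

theorem conj_apply_sub_self (g k : V ≃ᵃ[ℝ] V) (p : V) :
    (g * k * g⁻¹) (g p) - g p = g.linear (k p - p) := by
  rw [AffineEquiv.mul_apply_eq, AffineEquiv.mul_apply_eq, AffineEquiv.inv_apply_self_eq,
    affineEquiv_apply_sub_apply]

theorem sum_smul_apply_sub_self {ι : Type*} [Fintype ι] (γ : ι → (V ≃ᵃ[ℝ] V)) (l : ι → ℝ) (x : V) :
    ∑ i, l i • (γ i x - x) =
      (∑ i, l i • linA (γ i)) x + ∑ i, l i • translationPart (γ i) := by
  simp [affineEquiv_apply_sub_self, LinearMap.sum_apply, smul_add, Finset.sum_add_distrib]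

theorem countable_of_properlyDiscontinuous [FiniteDimensional ℝ V] (Γ : Subgroup (V ≃ᵃ[ℝ] V))
    [ProperlyDiscontinuousSMul Γ V] : Countable Γ := by
  have : ProperSpace V := FiniteDimensional.proper ℝ V
  rw [← Set.countable_univ_iff]
  refine (Set.countable_iUnion fun n : ℕ =>
    (ProperlyDiscontinuousSMul.finite_disjoint_inter_image (Γ := Γ) (T := V)
      (isCompact_singleton (x := 0)) (isCompact_closedBall 0 (n : ℝ))).countable).mono ?_
  intro g _
  obtain ⟨n, hn⟩ := exists_nat_ge ‖g • (0 : V)‖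
  exact Set.mem_iUnion.2 ⟨n, g • (0 : V), ⟨0, rfl, rfl⟩, by simpa using hn⟩

variable [FiniteDimensional ℝ V] {B : LinearMap.BilinForm ℝ V} {Γ : Subgroup (V ≃ᵃ[ℝ] V)}

theorem IsCompleteFlatHomogeneous.isNormalizerTransitive (h : IsCompleteFlatHomogeneous B Γ)
    (hs : ∀ x y, B x y = B y x) (hnd : ∀ x, (∀ y, B x y = 0) → x = 0) :
    IsNormalizerTransitive B Γ := by
  have := h.properlyDiscontinuous
  have := countable_of_properlyDiscontinuous Γ
  intro p q
  obtain ⟨f, hf, hpq⟩ := h.homogeneous (Quotient.mk _ p) (Quotient.mk _ q)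
  obtain ⟨g, hg, hgf⟩ := hf.exists_lift hs hnd
  have hconj : ∀ k ∈ Γ, g * k * g⁻¹ ∈ Γ := by
    intro k hk
    obtain ⟨k', hk', he⟩ := exists_affineEquiv_eq_mul (Γ := Γ) (g * k) g isOpen_univ
      Set.univ_nonempty fun y _ => by
        rw [← quotient_mk_eq_iff, AffineEquiv.mul_apply_eq, ← hgf, ← hgf]
        exact congrArg f ((quotient_mk_eq_iff Γ _ _).2 ⟨k, hk, rfl⟩)
    rw [← he]
    simpa using hk'
  have hconj' : ∀ k ∈ Γ, g⁻¹ * k * g ∈ Γ := by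
    intro k hk
    obtain ⟨k', hk', he⟩ := exists_affineEquiv_eq_mul (Γ := Γ) (g⁻¹ * k * g) 1 isOpen_univ
      Set.univ_nonempty fun y _ => by
        rw [← quotient_mk_eq_iff]
        apply f.injective
        rw [hgf, hgf, quotient_mk_eq_iff]
        refine ⟨k, hk, ?_⟩
        rw [AffineEquiv.mul_apply_eq, AffineEquiv.mul_apply_eq, AffineEquiv.apply_inv_self_eq]
        rfl
    rw [← he]
    simpa using hk'
  rw [hgf, eq_comm, quotient_mk_eq_iff] at hpq
  obtain ⟨k, hk, hkq⟩ := hpq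
  refine ⟨k * g, mul_mem (h.isometries hk) hg, fun j hj => ?_, fun j hj => ?_, hkq⟩
  · have := mul_mem (mul_mem hk (hconj j hj)) (inv_mem hk)
    simpa [mul_assoc] using this
  · have := hconj' _ (mul_mem (mul_mem (inv_mem hk) hj) hk)
    simpa [mul_assoc] using this

/-- Moving `x` to `0` by a normalizing isometry replaces `k₁, k₂` by conjugates in `Γ`, so this
continuous function of `x` takes only countably many values. Its range is connected, hence a point.
-/
theorem IsNormalizerTransitive.apply_displacement_eq [Countable Γ]
    (h : IsNormalizerTransitive B Γ) {k₁ k₂ : V ≃ᵃ[ℝ] V} (h₁ : k₁ ∈ Γ) (h₂ : k₂ ∈ Γ) (x : V) :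
    B (k₁ x - x) (k₂ x - x) = B (k₁ 0) (k₂ 0) := by
  have hcont : Continuous fun x : V => B (k₁ x - x) (k₂ x - x) := by
    let Bc : V →L[ℝ] V →L[ℝ] ℝ := LinearMap.toContinuousLinearMap
      ((LinearMap.toContinuousLinearMap : (V →ₗ[ℝ] ℝ) ≃ₗ[ℝ] (V →L[ℝ] ℝ)).toLinearMap ∘ₗ B)
    have c₁ : Continuous k₁ := k₁.toAffineMap.continuous_of_finiteDimensional
    have c₂ : Continuous k₂ := k₂.toAffineMap.continuous_of_finiteDimensional
    exact (Bc.continuous.comp (c₁.sub continuous_id)).clm_apply (c₂.sub continuous_id)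
  have hcount : (Set.range fun x : V => B (k₁ x - x) (k₂ x - x)).Countable := by
    refine (Set.countable_range fun p : Γ × Γ => B (p.1.1 0) (p.2.1 0)).mono ?_
    rintro _ ⟨x, rfl⟩
    obtain ⟨g, hg, -, hconj, rfl⟩ := h 0 x
    refine ⟨(⟨_, hconj k₁ h₁⟩, ⟨_, hconj k₂ h₂⟩), ?_⟩
    have e : ∀ k : V ≃ᵃ[ℝ] V, k (g 0) - g 0 = g.linear ((g⁻¹ * k * g) 0) := fun k => by
      have := conj_apply_sub_self g (g⁻¹ * k * g) 0
      rw [sub_zero] at this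
      rw [← this]
      congr 2
      group
    simp only [e]
    exact (hg _ _).symm
  have hsub := hcount.isTotallyDisconnected _ subset_rfl
    (isPreconnected_range hcont)
  have := hsub (Set.mem_range_self x) (Set.mem_range_self 0)
  simpa using this

theorem IsNormalizerTransitive.sum_smul_displacement_eq_zero [Countable Γ]
    (h : IsNormalizerTransitive B Γ) {ι : Type*} [Fintype ι] {γ : ι → (V ≃ᵃ[ℝ] V)}
    (hγ : ∀ i, γ i ∈ Γ) (l : ι → ℝ) {p : V} (hp : ∑ i, l i • (γ i p - p) = 0) (x : V) :
    ∑ i, l i • (γ i x - x) = 0 := by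
  -- Simultaneous conjugates of the tuple `γ` form a countable set, and each point of `V` is a zero
  -- of the combination for one of them. By Baire one combination vanishes identically; its
  -- conjugator carries this back to `γ`.
  let I := {τ : ι → Γ // ∃ g : V ≃ᵃ[ℝ] V, ∀ i, (τ i).1 = g * γ i * g⁻¹}
  have hconj : ∀ (g : V ≃ᵃ[ℝ] V) (q : V), ∑ i, l i • ((g * γ i * g⁻¹) (g q) - g q) =
      g.linear (∑ i, l i • (γ i q - q)) := fun g q => by
    simp only [conj_apply_sub_self, map_sum, map_smul]
  obtain ⟨⟨τ, g, hg⟩, hτ⟩ := exists_affineMap_eq_zero (fun τ : I =>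
    (∑ i, l i • linA (τ.1 i).1).toAffineMap +
      AffineMap.const ℝ V (∑ i, l i • translationPart (τ.1 i).1)) isOpen_univ
      Set.univ_nonempty fun y _ => by
        obtain ⟨g, -, hg, -, rfl⟩ := h p y
        refine ⟨⟨fun i => ⟨_, hg _ (hγ i)⟩, g, fun i => rfl⟩, ?_⟩
        have := hconj g p
        rw [hp, map_zero, sum_smul_apply_sub_self] at this
        exact this
  have h0 := congrArg (fun F : V →ᵃ[ℝ] V => F (g x)) hτ
  have h1 : ∑ i, l i • ((τ i).1 (g x) - g x) = 0 := by
    rw [sum_smul_apply_sub_self]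
    exact h0
  simp only [hg] at h1
  rw [hconj] at h1
  exact g.linear.map_eq_zero_iff.1 h1

end Normalizer

/-! ### Isotropic subspaces and skew maps -/

section Signature

variable {V : Type*} [AddCommGroup V] [Module ℝ V] {B : LinearMap.BilinForm ℝ V} {p q : ℕ}

theorem HasSignature.symm (h : HasSignature B p q) (x y : V) : B x y = B y x := by
  obtain ⟨e, he⟩ := h
  suffices B = B.flip from congrArg (fun F : LinearMap.BilinForm ℝ V => F x y) this
  refine e.ext fun i => e.ext fun j => ?_
  change B (e i) (e j) = B (e j) (e i)
  rw [he, he]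
  rcases eq_or_ne i j with rfl | hij
  · simp
  · simp [hij, hij.symm]

theorem HasSignature.eq_zero_of_forall (h : HasSignature B p q) (x : V) (hx : ∀ y, B x y = 0) :
    x = 0 := by
  obtain ⟨e, he⟩ := h
  refine e.ext_elem fun j => ?_
  have h1 := hx (e j)
  rw [← e.sum_repr x] at h1
  simp only [map_sum, map_smul, LinearMap.sum_apply, LinearMap.smul_apply, he, smul_eq_mul,
    mul_ite, mul_zero, Finset.sum_ite_eq', Finset.mem_univ, if_true] at h1
  rcases j with j | j <;> simpa using h1

theorem HasSignature.finrank_le_of_isotropic (h : HasSignature B p q) (S : Submodule ℝ V)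
    (hS : ∀ x ∈ S, B x x = 0) : Module.finrank ℝ S ≤ q := by
  obtain ⟨e, he⟩ := h
  -- Projection to the negative coordinates; its kernel is positive definite, so it meets `S`
  -- trivially.
  let π : V →ₗ[ℝ] (Fin q → ℝ) := LinearMap.pi fun j => e.coord (Sum.inr j)
  have hinj : Function.Injective (π.domRestrict S) := by
    rw [← LinearMap.ker_eq_bot, LinearMap.ker_eq_bot']
    rintro ⟨x, hx⟩ hπ
    have hq : ∀ j, e.repr x (Sum.inr j) = 0 := fun j => congrFun hπ j
    have h1 := hS x hx
    have h2 : ∀ z, B x z = ∑ i, e.repr x i * B (e i) z := fun z => by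
      conv_lhs => rw [← e.sum_repr x]
      simp only [map_sum, map_smul, LinearMap.sum_apply, LinearMap.smul_apply, smul_eq_mul]
    have h3 : ∀ i, B (e i) x = e.repr x i * Sum.elim (fun _ => (1 : ℝ)) (fun _ => -1) i := by
      intro i
      conv_lhs => rw [← e.sum_repr x]
      simp only [map_sum, map_smul, he, smul_eq_mul, mul_ite, mul_zero, Finset.sum_ite_eq,
        Finset.mem_univ, if_true]
    rw [h2] at h1
    simp only [h3, Fintype.sum_sum_type, hq, Sum.elim_inl, mul_one, zero_mul,
      Finset.sum_const_zero, add_zero] at h1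
    rw [Finset.sum_eq_zero_iff_of_nonneg fun i _ => mul_self_nonneg _] at h1
    ext1
    refine e.ext_elem fun i => ?_
    rcases i with i | i
    · simpa using h1 i (Finset.mem_univ i)
    · simpa using hq i
  simpa using LinearMap.finrank_le_finrank_of_injective hinj

end Signature

section Skew

variable {V : Type*} [AddCommGroup V] [Module ℝ V] [FiniteDimensional ℝ V]
  {B : LinearMap.BilinForm ℝ V}

/-- If the image were spanned by `a`, write `T x = c • a`. Skewness gives `B (T x) x = 0`, so `c =
0` or `x ⊥ a`, and in both cases `B (T x) z = -B x (T z)` vanishes for all `z`. -/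
theorem two_le_finrank_range_of_skew (hs : ∀ x y, B x y = B y x)
    (hnd : ∀ x, (∀ y, B x y = 0) → x = 0) {T : V →ₗ[ℝ] V}
    (hT : ∀ x y, B (T x) y = -B x (T y)) (hT0 : T ≠ 0) :
    2 ≤ Module.finrank ℝ (LinearMap.range T) := by
  by_contra! hlt
  obtain ⟨⟨a, ha₀⟩, ha⟩ := finrank_le_one_iff.1 (Nat.lt_succ_iff.1 hlt)
  have ha' : ∀ x, ∃ c : ℝ, c • a = T x := fun x => by
    obtain ⟨c, hc⟩ := ha ⟨T x, x, rfl⟩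
    exact ⟨c, congrArg Subtype.val hc⟩
  have hself : ∀ x, B (T x) x = 0 := fun x => by
    have := hT x x
    rw [hs x] at this
    linarith
  apply hT0
  ext x
  refine hnd _ fun z => ?_
  by_contra hz
  obtain ⟨c, hc⟩ := ha' x
  obtain ⟨d, hd⟩ := ha' z
  have hx := hself x
  rw [← hc, map_smul, LinearMap.smul_apply, smul_eq_mul] at hx
  rcases mul_eq_zero.1 hx with h | h
  · rw [← hc, h, zero_smul, map_zero] at hz
    exact hz rfl
  · rw [hT, ← hd, map_smul, hs, h, smul_zero, neg_zero] at hz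
    exact hz rfl

end Skew

/-! ### Algebra of the linear and translation parts of `Γ` -/

section Displacement

variable {V : Type*} [NormedAddCommGroup V] [NormedSpace ℝ V] [FiniteDimensional ℝ V]
  {B : LinearMap.BilinForm ℝ V} {Γ : Subgroup (V ≃ᵃ[ℝ] V)} [Countable Γ]

/-- These are the quadratic and linear terms in `x` of the constant displacement pairing, separated
by comparing `x` with `-x`. -/
theorem IsNormalizerTransitive.linA_apply_linA (h : IsNormalizerTransitive B Γ)
    {k₁ k₂ : V ≃ᵃ[ℝ] V} (h₁ : k₁ ∈ Γ) (h₂ : k₂ ∈ Γ) (x : V) :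
    B (linA k₁ x) (linA k₂ x) = 0 ∧
      B (linA k₁ x) (translationPart k₂) + B (translationPart k₁) (linA k₂ x) = 0 := by
  have e₁ := h.apply_displacement_eq h₁ h₂ x
  have e₂ := h.apply_displacement_eq h₁ h₂ (-x)
  simp only [affineEquiv_apply_sub_self, map_neg, map_add, LinearMap.add_apply,
    LinearMap.neg_apply] at e₁ e₂
  change _ = B (translationPart k₁) (translationPart k₂) at e₁ e₂
  constructor <;> linarith

theorem IsNormalizerTransitive.linA_apply_linA_polar (h : IsNormalizerTransitive B Γ)
    {k₁ k₂ : V ≃ᵃ[ℝ] V} (h₁ : k₁ ∈ Γ) (h₂ : k₂ ∈ Γ) (x y : V) :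
    B (linA k₁ x) (linA k₂ y) = -B (linA k₁ y) (linA k₂ x) := by
  have e := (h.linA_apply_linA h₁ h₂ (x + y)).1
  have ex := (h.linA_apply_linA h₁ h₂ x).1
  have ey := (h.linA_apply_linA h₁ h₂ y).1
  simp only [map_add, LinearMap.add_apply] at e
  linarith

theorem IsNormalizerTransitive.isotropic_range (h : IsNormalizerTransitive B Γ)
    (hs : ∀ x y, B x y = B y x) {k : V ≃ᵃ[ℝ] V} (hk : k ∈ Γ) (x y : V) :
    B (linA k x) (linA k y) = 0 := by
  have := h.linA_apply_linA_polar hk hk x y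
  rw [hs (linA k y)] at this
  linarith

theorem IsNormalizerTransitive.linA_skew (h : IsNormalizerTransitive B Γ)
    (hs : ∀ x y, B x y = B y x) (hΓ : Γ ≤ pseudoIso B) {k : V ≃ᵃ[ℝ] V} (hk : k ∈ Γ) (x y : V) :
    B (linA k x) y = -B x (linA k y) := by
  have e := hΓ hk x y
  have e₀ := h.isotropic_range hs hk x y
  have hl : ∀ z, k.linear z = z + linA k z := fun z => by simp [linA]
  rw [hl, hl] at e
  simp only [map_add, LinearMap.add_apply] at e
  linarith

theorem IsNormalizerTransitive.linA_anticomm (h : IsNormalizerTransitive B Γ)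
    (hs : ∀ x y, B x y = B y x) (hnd : ∀ x, (∀ y, B x y = 0) → x = 0) (hΓ : Γ ≤ pseudoIso B)
    {k₁ k₂ : V ≃ᵃ[ℝ] V} (h₁ : k₁ ∈ Γ) (h₂ : k₂ ∈ Γ) (x : V) :
    linA k₁ (linA k₂ x) = -linA k₂ (linA k₁ x) := by
  rw [eq_neg_iff_add_eq_zero]
  refine hnd _ fun y => ?_
  have e₁ := h.linA_skew hs hΓ h₁ (linA k₂ x) y
  have e₂ := h.linA_skew hs hΓ h₂ (linA k₁ x) y
  have e₃ := h.linA_apply_linA_polar h₁ h₂ y x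
  rw [hs (linA k₁ y)] at e₃
  rw [map_add, LinearMap.add_apply]
  linarith

/-- Anticommuting skew maps have a skew product, so a nonzero product has rank at least 2. Both
factors have isotropic image, of dimension at most 2, so all three images coincide; then `A₁A₂ x`
has the form `A₁A₁ z`, which is zero because `A₁` is skew with isotropic image. -/
theorem IsNormalizerTransitive.linA_comp_linA (h : IsNormalizerTransitive B Γ)
    (hs : ∀ x y, B x y = B y x) (hnd : ∀ x, (∀ y, B x y = 0) → x = 0) (hΓ : Γ ≤ pseudoIso B)
    (hdim : ∀ S : Submodule ℝ V, (∀ x ∈ S, B x x = 0) → Module.finrank ℝ S ≤ 2)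
    {k₁ k₂ : V ≃ᵃ[ℝ] V} (h₁ : k₁ ∈ Γ) (h₂ : k₂ ∈ Γ) : linA k₁ ∘ₗ linA k₂ = 0 := by
  by_contra hne
  have hskew : ∀ x y, B ((linA k₁ ∘ₗ linA k₂) x) y = -B x ((linA k₁ ∘ₗ linA k₂) y) := by
    intro x y
    simp only [LinearMap.comp_apply]
    rw [h.linA_skew hs hΓ h₁, h.linA_skew hs hΓ h₂, h.linA_anticomm hs hnd hΓ h₁ h₂, map_neg]
  have hrank := two_le_finrank_range_of_skew hs hnd hskew hne
  have hle : ∀ {k : V ≃ᵃ[ℝ] V}, k ∈ Γ → Module.finrank ℝ (LinearMap.range (linA k)) ≤ 2 := by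
    intro k hk
    refine hdim _ ?_
    rintro _ ⟨x, rfl⟩
    exact h.isotropic_range hs hk x x
  have r₁ : LinearMap.range (linA k₁ ∘ₗ linA k₂) = LinearMap.range (linA k₁) :=
    Submodule.eq_of_le_of_finrank_le (LinearMap.range_comp_le_range _ _) ((hle h₁).trans hrank)
  have r₂ : LinearMap.range (linA k₁ ∘ₗ linA k₂) = LinearMap.range (linA k₂) := by
    refine Submodule.eq_of_le_of_finrank_le ?_ ((hle h₂).trans hrank)
    rintro _ ⟨x, rfl⟩
    exact ⟨-linA k₁ x, by
      rw [LinearMap.comp_apply, h.linA_anticomm hs hnd hΓ h₁ h₂, map_neg]⟩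
  apply hne
  ext x
  obtain ⟨z, hz⟩ : linA k₂ x ∈ LinearMap.range (linA k₁) := by
    rw [← r₁, r₂]
    exact ⟨x, rfl⟩
  rw [LinearMap.comp_apply, ← hz, LinearMap.zero_apply]
  refine hnd _ fun y => ?_
  rw [h.linA_skew hs hΓ h₁, h.isotropic_range hs h₁, neg_zero]

/-- `A₁A₂ = 0` makes the two images orthogonal, so their sum is isotropic of dimension at most 2,
already filled by the image of `A₁`. -/
theorem IsNormalizerTransitive.range_linA_eq (h : IsNormalizerTransitive B Γ)
    (hs : ∀ x y, B x y = B y x) (hnd : ∀ x, (∀ y, B x y = 0) → x = 0) (hΓ : Γ ≤ pseudoIso B)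
    (hdim : ∀ S : Submodule ℝ V, (∀ x ∈ S, B x x = 0) → Module.finrank ℝ S ≤ 2)
    {k₁ k₂ : V ≃ᵃ[ℝ] V} (h₁ : k₁ ∈ Γ) (h₂ : k₂ ∈ Γ) (hk₁ : linA k₁ ≠ 0) :
    LinearMap.range (linA k₂) ≤ LinearMap.range (linA k₁) := by
  have hsup : Module.finrank ℝ ↥(LinearMap.range (linA k₁) ⊔ LinearMap.range (linA k₂)) ≤ 2 := by
    refine hdim _ fun z hz => ?_
    obtain ⟨_, ⟨x, rfl⟩, _, ⟨y, rfl⟩, rfl⟩ := Submodule.mem_sup.1 hz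
    have h0 : B (linA k₁ x) (linA k₂ y) = 0 := by
      rw [h.linA_skew hs hΓ h₁]
      have := LinearMap.congr_fun (h.linA_comp_linA hs hnd hΓ hdim h₁ h₂) y
      rw [LinearMap.comp_apply, LinearMap.zero_apply] at this
      rw [this, map_zero, neg_zero]
    simp only [map_add, LinearMap.add_apply, h.isotropic_range hs h₁, h.isotropic_range hs h₂,
      h0, hs (linA k₂ y)]
    simp
  have := Submodule.eq_of_le_of_finrank_le le_sup_left
    (hsup.trans (two_le_finrank_range_of_skew hs hnd (h.linA_skew hs hΓ h₁) hk₁))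
  rw [this]
  exact le_sup_right

theorem IsNormalizerTransitive.holonomySpace_eq_range (h : IsNormalizerTransitive B Γ)
    (hs : ∀ x y, B x y = B y x) (hnd : ∀ x, (∀ y, B x y = 0) → x = 0) (hΓ : Γ ≤ pseudoIso B)
    (hdim : ∀ S : Submodule ℝ V, (∀ x ∈ S, B x x = 0) → Module.finrank ℝ S ≤ 2)
    {k : V ≃ᵃ[ℝ] V} (hk : k ∈ Γ) (hk0 : linA k ≠ 0) :
    holonomySpace Γ = LinearMap.range (linA k) :=
  le_antisymm (iSup₂_le fun _ hj => h.range_linA_eq hs hnd hΓ hdim hk hj hk0)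
    (le_iSup₂_of_le k hk le_rfl)

omit [FiniteDimensional ℝ V] [Countable Γ] in
theorem holonomySpace_eq_bot (h0 : ∀ k ∈ Γ, linA k = 0) : holonomySpace Γ = ⊥ := by
  rw [holonomySpace, iSup₂_eq_bot]
  intro k hk
  rw [h0 k hk, LinearMap.range_zero]

omit [FiniteDimensional ℝ V] [Countable Γ] in
theorem linA_apply_mem_holonomySpace {k : V ≃ᵃ[ℝ] V} (hk : k ∈ Γ) (x : V) :
    linA k x ∈ holonomySpace Γ :=
  (le_iSup₂_of_le k hk le_rfl : LinearMap.range (linA k) ≤ holonomySpace Γ) ⟨x, rfl⟩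

theorem IsNormalizerTransitive.holonomySpace_isotropic (h : IsNormalizerTransitive B Γ)
    (hs : ∀ x y, B x y = B y x) (hnd : ∀ x, (∀ y, B x y = 0) → x = 0) (hΓ : Γ ≤ pseudoIso B)
    (hdim : ∀ S : Submodule ℝ V, (∀ x ∈ S, B x x = 0) → Module.finrank ℝ S ≤ 2) :
    ∀ x ∈ holonomySpace Γ, ∀ y ∈ holonomySpace Γ, B x y = 0 := by
  by_cases h0 : ∀ k ∈ Γ, linA k = 0
  · rw [holonomySpace_eq_bot h0]
    rintro x hx y -
    rw [(Submodule.mem_bot ℝ).1 hx, map_zero, LinearMap.zero_apply]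
  · push Not at h0
    obtain ⟨k, hk, hk0⟩ := h0
    rw [h.holonomySpace_eq_range hs hnd hΓ hdim hk hk0]
    rintro _ ⟨x, rfl⟩ _ ⟨y, rfl⟩
    exact h.isotropic_range hs hk x y

theorem IsNormalizerTransitive.linA_apply_eq_zero (h : IsNormalizerTransitive B Γ)
    (hs : ∀ x y, B x y = B y x) (hnd : ∀ x, (∀ y, B x y = 0) → x = 0) (hΓ : Γ ≤ pseudoIso B)
    {k : V ≃ᵃ[ℝ] V} (hk : k ∈ Γ) {x : V} (hx : x ∈ B.orthogonal (holonomySpace Γ)) :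
    linA k x = 0 := by
  refine hnd _ fun y => ?_
  rw [h.linA_skew hs hΓ hk, hs, hx _ (linA_apply_mem_holonomySpace hk y), neg_zero]

theorem IsNormalizerTransitive.translationPart_mem (h : IsNormalizerTransitive B Γ)
    (hs : ∀ x y, B x y = B y x) (hnd : ∀ x, (∀ y, B x y = 0) → x = 0) (hΓ : Γ ≤ pseudoIso B)
    (hdim : ∀ S : Submodule ℝ V, (∀ x ∈ S, B x x = 0) → Module.finrank ℝ S ≤ 2)
    {k : V ≃ᵃ[ℝ] V} (hk : k ∈ Γ) : translationPart k ∈ B.orthogonal (holonomySpace Γ) := by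
  by_cases h0 : ∀ j ∈ Γ, linA j = 0
  · rw [holonomySpace_eq_bot h0]
    intro x hx
    rw [(Submodule.mem_bot ℝ).1 hx, map_zero, LinearMap.zero_apply]
  · push Not at h0
    obtain ⟨j, hj, hj0⟩ := h0
    -- `U_Γ` is the image of any nonzero linear part: that of `j` if `k` is a translation, otherwise
    -- that of `k` itself, where the linear term reads `2 B (A x) v = 0`.
    by_cases hk0 : linA k = 0
    · rw [h.holonomySpace_eq_range hs hnd hΓ hdim hj hj0]
      rintro _ ⟨x, rfl⟩
      have := (h.linA_apply_linA hj hk x).2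
      rwa [hk0, LinearMap.zero_apply, map_zero, add_zero] at this
    · rw [h.holonomySpace_eq_range hs hnd hΓ hdim hk hk0]
      rintro _ ⟨x, rfl⟩
      have := (h.linA_apply_linA hk hk x).2
      rw [hs (translationPart k)] at this
      change B (linA k x) (translationPart k) = 0
      linarith

theorem IsNormalizerTransitive.translationPart_mul (h : IsNormalizerTransitive B Γ)
    (hs : ∀ x y, B x y = B y x) (hnd : ∀ x, (∀ y, B x y = 0) → x = 0) (hΓ : Γ ≤ pseudoIso B)
    (hdim : ∀ S : Submodule ℝ V, (∀ x ∈ S, B x x = 0) → Module.finrank ℝ S ≤ 2)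
    {k₁ k₂ : V ≃ᵃ[ℝ] V} (h₁ : k₁ ∈ Γ) (h₂ : k₂ ∈ Γ) :
    translationPart (k₁ * k₂) = translationPart k₁ + translationPart k₂ := by
  have e := affineEquiv_apply_sub_self k₁ (translationPart k₂)
  rw [h.linA_apply_eq_zero hs hnd hΓ h₁ (h.translationPart_mem hs hnd hΓ hdim h₂), zero_add,
    sub_eq_iff_eq_add] at e
  exact e

/-- A real combination of linear parts of `Γ` vanishes if the corresponding combination of
translation parts lies in `U_Γ`. -/
theorem IsNormalizerTransitive.sum_smul_linA_eq_zero (h : IsNormalizerTransitive B Γ)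
    (hs : ∀ x y, B x y = B y x) (hnd : ∀ x, (∀ y, B x y = 0) → x = 0) (hΓ : Γ ≤ pseudoIso B)
    (hdim : ∀ S : Submodule ℝ V, (∀ x ∈ S, B x x = 0) → Module.finrank ℝ S ≤ 2)
    {ι : Type*} [Fintype ι] {γ : ι → (V ≃ᵃ[ℝ] V)} (hγ : ∀ i, γ i ∈ Γ) (l : ι → ℝ)
    (hl : ∑ i, l i • translationPart (γ i) ∈ holonomySpace Γ) : ∑ i, l i • linA (γ i) = 0 := by
  set T := ∑ i, l i • linA (γ i) with hT
  by_contra hne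
  have hskew : ∀ x y, B (T x) y = -B x (T y) := fun x y => by
    simp [hT, LinearMap.sum_apply, h.linA_skew hs hΓ (hγ _) x]
  have hrange : LinearMap.range T = holonomySpace Γ := by
    refine Submodule.eq_of_le_of_finrank_le ?_ ((hdim _ fun x hx =>
      h.holonomySpace_isotropic hs hnd hΓ hdim x hx x hx).trans
        (two_le_finrank_range_of_skew hs hnd hskew hne))
    rintro _ ⟨x, rfl⟩
    rw [hT, LinearMap.sum_apply]
    exact sum_mem fun i _ => Submodule.smul_mem _ _ (linA_apply_mem_holonomySpace (hγ i) x)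
  -- As `T` maps onto `U_Γ`, the combined displacement `T x + ∑ l i • v i` has a zero `p`, and
  -- therefore vanishes identically.
  obtain ⟨p, hp⟩ := hrange.ge (neg_mem hl)
  have hall := h.sum_smul_displacement_eq_zero hγ l (p := p) (by
    rw [sum_smul_apply_sub_self, ← hT, hp, neg_add_cancel])
  simp only [sum_smul_apply_sub_self, ← hT] at hall
  have hv := hall 0
  rw [map_zero, zero_add] at hv
  apply hne
  ext x
  simpa [hv] using hall x

end Displacement

/-! ### The lattice of translation parts -/

section TranslationSubgroup

variable {V : Type*}

/-- The additive group of translation parts of a group of affine maps on which taking translation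
parts is a homomorphism. -/
def translationSubgroup [AddCommGroup V] [Module ℝ V] (S : Subgroup (V ≃ᵃ[ℝ] V))
    (hS : ∀ k₁ ∈ S, ∀ k₂ ∈ S,
      translationPart (k₁ * k₂) = translationPart k₁ + translationPart k₂) : AddSubgroup V where
  carrier := {v | ∃ k ∈ S, translationPart k = v}
  zero_mem' := ⟨1, S.one_mem, rfl⟩
  add_mem' := by
    rintro _ _ ⟨k₁, h₁, rfl⟩ ⟨k₂, h₂, rfl⟩
    exact ⟨k₁ * k₂, mul_mem h₁ h₂, hS _ h₁ _ h₂⟩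
  neg_mem' := by
    rintro _ ⟨k, hk, rfl⟩
    refine ⟨k⁻¹, inv_mem hk, eq_neg_of_add_eq_zero_left ?_⟩
    rw [← hS _ (inv_mem hk) _ hk, inv_mul_cancel]
    rfl

variable [NormedAddCommGroup V] [NormedSpace ℝ V] [FiniteDimensional ℝ V]
  {Γ : Subgroup (V ≃ᵃ[ℝ] V)}

/-- The translation parts are the orbit of `0`, which meets the unit ball in a finite set. -/
theorem discreteTopology_translationSubgroup [ProperlyDiscontinuousSMul Γ V]
    (hΓ : ∀ k₁ ∈ Γ, ∀ k₂ ∈ Γ,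
      translationPart (k₁ * k₂) = translationPart k₁ + translationPart k₂) :
    DiscreteTopology (translationSubgroup Γ hΓ) := by
  have : ProperSpace V := FiniteDimensional.proper ℝ V
  have hfin : {v | v ∈ translationSubgroup Γ hΓ ∧ v ∈ Metric.closedBall (0 : V) 1}.Finite := by
    refine ((ProperlyDiscontinuousSMul.finite_disjoint_inter_image (Γ := Γ) (T := V)
      (isCompact_singleton (x := 0)) (isCompact_closedBall 0 1)).image
        fun k : Γ => translationPart k.1).subset ?_
    rintro _ ⟨⟨k, hk, rfl⟩, hb⟩
    exact ⟨⟨k, hk⟩, ⟨translationPart k, ⟨0, rfl, rfl⟩, hb⟩, rfl⟩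
  refine discreteTopology_of_isOpen_singleton_zero ?_
  have hopen : IsOpen (Metric.ball (0 : V) 1 ∩
      ({v | v ∈ translationSubgroup Γ hΓ ∧ v ∈ Metric.closedBall (0 : V) 1} \ {0})ᶜ) :=
    Metric.isOpen_ball.inter hfin.sdiff.isClosed.isOpen_compl
  convert hopen.preimage (continuous_subtype_val (p := fun v => v ∈ translationSubgroup Γ hΓ))
  ext ⟨v, hv⟩
  constructor
  · rintro h
    have h0 : v = 0 := congrArg Subtype.val h
    subst h0
    exact ⟨by simp, fun h => h.2 rfl⟩
  · rintro ⟨h₁, h₂⟩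
    refine Subtype.ext ?_
    by_contra h0
    exact h₂ ⟨⟨hv, Metric.ball_subset_closedBall h₁⟩, h0⟩

/-- A `ℤ`-basis of a discrete subgroup of `V` is linearly independent over `ℝ`. Its lifts generate
`Γ` because a free action lets the image of `0` determine the element. -/
theorem exists_generators_linearIndependent [ProperlyDiscontinuousSMul Γ V]
    (hfree : ∀ g ∈ Γ, ∀ x : V, g x = x → g = 1)
    (hΓ : ∀ k₁ ∈ Γ, ∀ k₂ ∈ Γ,
      translationPart (k₁ * k₂) = translationPart k₁ + translationPart k₂) :
    ∃ (N : ℕ) (γ : Fin N → (V ≃ᵃ[ℝ] V)), Subgroup.closure (Set.range γ) = Γ ∧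
      LinearIndependent ℝ (fun i => translationPart (γ i)) := by
  let L : Submodule ℤ V := AddSubgroup.toIntSubmodule (translationSubgroup Γ hΓ)
  have hL : DiscreteTopology L := discreteTopology_translationSubgroup hΓ
  let b : Module.Basis (Fin (Module.finrank ℤ L)) ℤ L := Module.finBasis ℤ L
  choose γ hγ hγb using fun i => ((b i).2 : (b i : V) ∈ translationSubgroup Γ hΓ)
  have hspan : Submodule.span ℤ (Set.range fun i => (b i : V)) = L := by
    have := congrArg (Submodule.map L.subtype) b.span_eq
    rw [Submodule.map_span, Submodule.map_subtype_top, ← Set.range_comp] at this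
    exact this
  refine ⟨_, γ, le_antisymm ?_ ?_, ?_⟩
  · rw [Subgroup.closure_le]
    rintro _ ⟨i, rfl⟩
    exact hγ i
  · have hle : Subgroup.closure (Set.range γ) ≤ Γ := by
      rw [Subgroup.closure_le]
      rintro _ ⟨i, rfl⟩
      exact hγ i
    let D := translationSubgroup (Subgroup.closure (Set.range γ))
      fun k₁ h₁ k₂ h₂ => hΓ k₁ (hle h₁) k₂ (hle h₂)
    have hD : L ≤ AddSubgroup.toIntSubmodule D := by
      rw [← hspan, Submodule.span_le]
      rintro _ ⟨i, rfl⟩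
      exact ⟨γ i, Subgroup.subset_closure ⟨i, rfl⟩, hγb i⟩
    intro k hk
    obtain ⟨j, hj, hjk⟩ : translationPart k ∈ D := hD ⟨k, hk, rfl⟩
    have h1 : j⁻¹ * k = 1 := by
      refine hfree _ (mul_mem (inv_mem (hle hj)) hk) 0 ?_
      change j⁻¹ (translationPart k) = 0
      rw [← hjk]
      exact AffineEquiv.inv_apply_self_eq j 0
    rwa [← inv_mul_eq_one.1 h1]
  · simp only [hγb]
    have hdisc : DiscreteTopology (Submodule.span ℤ (Set.range fun i => (b i : V))) := by
      rw [hspan]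
      exact hL
    rw [linearIndependent_iff_card_eq_finrank_span,
      Real.finrank_eq_int_finrank_of_discrete hdisc, Set.finrank, hspan, Fintype.card_fin]

end TranslationSubgroup

/-! ### Coordinates in a Witt basis -/

namespace WittBasis

variable {V : Type*} [AddCommGroup V] [Module ℝ V] {B : LinearMap.BilinForm ℝ V}
  {U : Submodule ℝ V} {k m : ℕ} (b : WittBasis B U k m)

theorem repr_inr_of_mem {x : V} (hx : x ∈ U) (j : Fin m ⊕ Fin k) :
    b.basis.repr x (Sum.inr j) = 0 := by
  have hle : U ≤ LinearMap.ker (b.basis.coord (Sum.inr j)) := by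
    refine b.span_u.ge.trans (Submodule.span_le.2 ?_)
    rintro _ ⟨i, rfl⟩
    simp
  exact hle hx

theorem basis_inl_mem (i : Fin k) : b.basis (Sum.inl i) ∈ U := by
  have h := Submodule.subset_span (R := ℝ) (Set.mem_range_self (f := fun i => b.basis (Sum.inl i)) i)
  rwa [b.span_u] at h

theorem repr_inr_inr_of_mem_orthogonal {x : V} (hx : x ∈ B.orthogonal U) (j : Fin k) :
    b.basis.repr x (Sum.inr (Sum.inr j)) = 0 := by
  have hle : B.orthogonal U ≤ LinearMap.ker (b.basis.coord (Sum.inr (Sum.inr j))) := by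
    rw [b.orthogonal_eq]
    refine sup_le (fun x hx => b.repr_inr_of_mem hx _) (Submodule.span_le.2 ?_)
    rintro _ ⟨i, rfl⟩
    simp
  exact hle hx

theorem mem_of_repr_inr {x : V} (hx : ∀ j, b.basis.repr x (Sum.inr j) = 0) : x ∈ U := by
  rw [← b.basis.sum_repr x, Fintype.sum_sum_type]
  simp only [hx, zero_smul, Finset.sum_const_zero, add_zero]
  exact sum_mem fun i _ => Submodule.smul_mem _ _ (b.basis_inl_mem i)

theorem basis_inl_mem_orthogonal (hU : ∀ x ∈ U, ∀ y ∈ U, B x y = 0) (i : Fin k) :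
    b.basis (Sum.inl i) ∈ B.orthogonal U :=
  fun x hx => hU x hx _ (b.basis_inl_mem i)

theorem basis_inr_inl_mem_orthogonal (i : Fin m) :
    b.basis (Sum.inr (Sum.inl i)) ∈ B.orthogonal U := by
  rw [b.orthogonal_eq]
  exact Submodule.mem_sup_right (Submodule.subset_span ⟨i, rfl⟩)

theorem apply_basis_inr_inr {x : V} (hx : x ∈ U) (i : Fin k) :
    B x (b.basis (Sum.inr (Sum.inr i))) = b.basis.repr x (Sum.inl i) := by
  conv_lhs => rw [← b.basis.sum_repr x, Fintype.sum_sum_type]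
  simp [b.repr_inr_of_mem hx, b.dual]

theorem blockC_apply (g : V ≃ᵃ[ℝ] V) (i j : Fin k) :
    b.blockC g i j = b.basis.repr (linA g (b.basis (Sum.inr (Sum.inr j)))) (Sum.inl i) := by
  simp [blockC, linMatrix, LinearMap.toMatrix_apply, linA]

theorem sum_smul_blockC_apply {ι : Type*} [Fintype ι] (γ : ι → (V ≃ᵃ[ℝ] V)) (l : ι → ℝ)
    (i j : Fin k) :
    (∑ a, l a • b.blockC (γ a)) i j =
      b.basis.repr ((∑ a, l a • linA (γ a)) (b.basis (Sum.inr (Sum.inr j)))) (Sum.inl i) := by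
  simp [Matrix.sum_apply, blockC_apply, LinearMap.sum_apply, Finsupp.finsetSum_apply]

theorem sum_smul_compW_apply {ι : Type*} [Fintype ι] (γ : ι → (V ≃ᵃ[ℝ] V)) (l : ι → ℝ)
    (i : Fin m) :
    (∑ a, l a • b.compW (γ a)) i =
      b.basis.repr (∑ a, l a • translationPart (γ a)) (Sum.inr (Sum.inl i)) := by
  simp [compW, transCoord, Finset.sum_apply, Finsupp.finsetSum_apply]

/-- A linear map into `U` vanishing on `U^⊥` is determined by its upper right block. -/
theorem eq_zero_of_repr_eq_zero (hU : ∀ x ∈ U, ∀ y ∈ U, B x y = 0) {T : V →ₗ[ℝ] V}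
    (hTU : ∀ x, T x ∈ U) (hT : ∀ x ∈ B.orthogonal U, T x = 0)
    (h : ∀ i j, b.basis.repr (T (b.basis (Sum.inr (Sum.inr j)))) (Sum.inl i) = 0) : T = 0 := by
  refine b.basis.ext fun j => ?_
  rcases j with j | j | j
  · exact hT _ (b.basis_inl_mem_orthogonal hU j)
  · exact hT _ (b.basis_inr_inl_mem_orthogonal j)
  · refine b.basis.ext_elem fun i => ?_
    rw [LinearMap.zero_apply, map_zero, Finsupp.zero_apply]
    rcases i with i | i
    · exact h i j
    · exact b.repr_inr_of_mem (hTU _) i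

/-- By duality `C i j` is the number `B (A u_j*) u_i*`, so skewness of `A` becomes skewness of the
matrix. -/
theorem blockC_skew (hs : ∀ x y, B x y = B y x) {g : V ≃ᵃ[ℝ] V}
    (hskew : ∀ x y, B (linA g x) y = -B x (linA g y)) (hTU : ∀ x, linA g x ∈ U) (i j : Fin k) :
    b.blockC g i j = -b.blockC g j i := by
  rw [blockC_apply, blockC_apply, ← b.apply_basis_inr_inr (hTU _),
    ← b.apply_basis_inr_inr (hTU _), hskew, hs]

theorem linMatrix_eq (hU : ∀ x ∈ U, ∀ y ∈ U, B x y = 0) {g : V ≃ᵃ[ℝ] V}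
    (hTU : ∀ x, linA g x ∈ U) (hT : ∀ x ∈ B.orthogonal U, linA g x = 0) :
    b.linMatrix g = upperRightBlock (b.blockC g) := by
  have hl : ∀ z, g.linear z = z + linA g z := fun z => by simp [linA]
  have hu : ∀ j, g.linear (b.basis (Sum.inl j)) = b.basis (Sum.inl j) := fun j => by
    rw [hl, hT _ (b.basis_inl_mem_orthogonal hU j), add_zero]
  have hw : ∀ j, g.linear (b.basis (Sum.inr (Sum.inl j))) = b.basis (Sum.inr (Sum.inl j)) :=
    fun j => by rw [hl, hT _ (b.basis_inr_inl_mem_orthogonal j), add_zero]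
  ext i j
  rcases j with j | j | j
  · rcases i with i | i | i <;>
      simp [linMatrix, LinearMap.toMatrix_apply, upperRightBlock, hu, Matrix.one_apply,
        Finsupp.single_apply, eq_comm]
  · rcases i with i | i | i <;>
      simp [linMatrix, LinearMap.toMatrix_apply, upperRightBlock, hw, Matrix.one_apply,
        Finsupp.single_apply, eq_comm]
  · rcases i with i | i | i
    · simp [blockC, upperRightBlock]
    · simp [linMatrix, LinearMap.toMatrix_apply, upperRightBlock, hl, b.repr_inr_of_mem (hTU _)]
    · simp [linMatrix, LinearMap.toMatrix_apply, upperRightBlock, hl, b.repr_inr_of_mem (hTU _),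
        Matrix.one_apply, Finsupp.single_apply, eq_comm]

end WittBasis

/-! ### Existence of Witt bases -/

section Existence

variable {V : Type*} [AddCommGroup V] [Module ℝ V] [FiniteDimensional ℝ V]
  {B : LinearMap.BilinForm ℝ V}

theorem exists_dual_family (hB : B.Nondegenerate) (hs : ∀ x y, B x y = B y x)
    {U : Submodule ℝ V} {k : ℕ} (u : Module.Basis (Fin k) ℝ U) :
    ∃ v : Fin k → V, ∀ (x : U) j, B x (v j) = u.repr x j := by
  choose φ hφ using fun j => LinearMap.exists_extend (u.coord j)
  refine ⟨fun j => (B.toDual hB).symm (φ j), fun x j => ?_⟩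
  rw [hs, LinearMap.BilinForm.apply_toDual_symm_apply]
  exact LinearMap.congr_fun (hφ j) x

/-- For a complement `W'` of `U`, the modular law makes `W' ⊓ U^⊥` a complement of `U` in `U^⊥`. The
`u_j*` only have to pair correctly with `U`, so any vectors representing extensions of the
coordinate functionals will do. -/
theorem nonempty_wittBasis (hB : B.Nondegenerate) (hs : ∀ x y, B x y = B y x)
    {U : Submodule ℝ V} (hU : ∀ x ∈ U, ∀ y ∈ U, B x y = 0) {k m : ℕ}
    (hk : Module.finrank ℝ U = k) (hm : Module.finrank ℝ V = k + m + k) :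
    Nonempty (WittBasis B U k m) := by
  have hrefl : B.IsRefl := fun x y h => by rw [hs, h]
  have hle : U ≤ B.orthogonal U := fun y hy x hx => hU x hx y hy
  obtain ⟨W', hW'⟩ := U.exists_isCompl
  let W := W' ⊓ B.orthogonal U
  have hsup : U ⊔ W = B.orthogonal U := by
    rw [← sup_inf_assoc_of_le W' hle, hW'.sup_eq_top, top_inf_eq]
  have hinf : U ⊓ W = ⊥ := by
    rw [← inf_assoc, hW'.inf_eq_bot, bot_inf_eq]
  have hWm : Module.finrank ℝ W = m := by
    have h1 := Submodule.finrank_sup_add_finrank_inf_eq U W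
    rw [hsup, hinf, LinearMap.BilinForm.finrank_orthogonal hB, finrank_bot] at h1
    omega
  let u := Module.finBasisOfFinrankEq ℝ U hk
  let w := Module.finBasisOfFinrankEq ℝ W hWm
  obtain ⟨v, hv⟩ := exists_dual_family hB hs u
  have hspan : ∀ {S : Submodule ℝ V} {r : ℕ} (e : Module.Basis (Fin r) ℝ S),
      Submodule.span ℝ (Set.range fun i => (e i : V)) = S := by
    intro S r e
    have := congrArg (Submodule.map S.subtype) e.span_eq
    rw [Submodule.map_span, Submodule.map_subtype_top, ← Set.range_comp] at this
    exact this
  let f : Fin k ⊕ Fin m ⊕ Fin k → V :=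
    Sum.elim (fun i => (u i : V)) (Sum.elim (fun i => (w i : V)) v)
  have hf : LinearIndependent ℝ f := by
    rw [Fintype.linearIndependent_iff]
    intro c hc
    simp only [Fintype.sum_sum_type, f, Sum.elim_inl, Sum.elim_inr] at hc
    -- Pairing with `u_i` kills the `U` and `W` terms and leaves the coefficient of `u_i*`.
    have hv0 : ∀ i, c (Sum.inr (Sum.inr i)) = 0 := by
      intro i
      have h1 := congrArg (B (u i)) hc
      have hu : ∀ j, B (u i) (u j) = 0 := fun j => hU _ (u i).2 _ (u j).2
      have hw : ∀ j, B (u i) (w j) = 0 := fun j => (w j).2.2 _ (u i).2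
      simpa [hu, hw, hv, Finsupp.single_apply] using h1
    simp only [hv0, zero_smul, Finset.sum_const_zero, add_zero] at hc
    have hx : ∑ j, c (Sum.inl j) • (u j : V) ∈ U ⊓ W := by
      refine ⟨sum_mem fun j _ => U.smul_mem _ (u j).2, ?_⟩
      rw [eq_neg_of_add_eq_zero_left hc]
      exact neg_mem (sum_mem fun j _ => W.smul_mem _ (w j).2)
    rw [hinf, Submodule.mem_bot] at hx
    rw [hx, zero_add] at hc
    have hu0 := Fintype.linearIndependent_iff.1
      (u.linearIndependent.map' U.subtype U.ker_subtype) (fun j => c (Sum.inl j)) hx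
    have hw0 := Fintype.linearIndependent_iff.1
      (w.linearIndependent.map' W.subtype W.ker_subtype) (fun j => c (Sum.inr (Sum.inl j))) hc
    rintro (i | i | i)
    exacts [hu0 i, hw0 i, hv0 i]
  let e : Module.Basis (Fin k ⊕ Fin m ⊕ Fin k) ℝ V :=
    Module.Basis.mk hf (hf.span_eq_top_of_card_eq_finrank' (by simp [hm, add_assoc])).ge
  have heu : ∀ i, e (Sum.inl i) = u i := fun i => by simp [e, f]
  have hew : ∀ i, e (Sum.inr (Sum.inl i)) = w i := fun i => by simp [e, f]
  have hev : ∀ i, e (Sum.inr (Sum.inr i)) = v i := fun i => by simp [e, f]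
  have hspanW : Submodule.span ℝ (Set.range fun i => e (Sum.inr (Sum.inl i))) = W := by
    simp only [hew]
    exact hspan w
  refine ⟨⟨e, ?_, ?_, ?_, ?_⟩⟩
  · simp only [heu]
    exact hspan u
  · rw [hspanW]
    refine LinearMap.BilinForm.nondegenerate_restrict_of_disjoint_orthogonal B hrefl ?_
    rw [Submodule.disjoint_def]
    intro x hxW hx
    -- A radical vector of `W` is orthogonal to `U ⊔ W = U^⊥`, so it lies in `U^⊥⊥ = U`, which meets
    -- `W` trivially.
    have hxU : x ∈ B.orthogonal (B.orthogonal U) := by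
      rw [← hsup]
      intro y hy
      obtain ⟨a, ha, c, hc, rfl⟩ := Submodule.mem_sup.1 hy
      change B (a + c) x = 0
      rw [map_add, LinearMap.add_apply, hxW.2 a ha, hx c hc, add_zero]
    rw [LinearMap.BilinForm.orthogonal_orthogonal hB hrefl] at hxU
    exact (Submodule.mem_bot ℝ).1 (hinf ▸ ⟨hxU, hxW⟩)
  · rw [hspanW, hsup]
  · intro i j
    rw [heu, hev, hv, u.repr_self, Finsupp.single_apply]

end Existence

/-! ### Assembly of the three statements -/

theorem proposition4p7 (n : ℕ) (hn : 4 ≤ n) (B : LinearMap.BilinForm ℝ (Fin n → ℝ))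
    (hB : HasSignature B (n - 2) 2)
    (Γ : Subgroup ((Fin n → ℝ) ≃ᵃ[ℝ] (Fin n → ℝ)))
    (hΓ : IsCompleteFlatHomogeneous B Γ) :
    ∃ (N : ℕ) (γ : Fin N → ((Fin n → ℝ) ≃ᵃ[ℝ] (Fin n → ℝ))),
      -- (1) the `γ i` generate `Γ` and have linearly independent translation parts
      (Subgroup.closure (Set.range γ) = Γ ∧
        LinearIndependent ℝ (fun i => translationPart (γ i))) ∧
      -- (2) normal form in any Witt basis with respect to `U_Γ`, and such bases exist
      ((∃ g ∈ Γ, linA g ≠ 0) →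
        Nonempty (WittBasis B (holonomySpace Γ) 2 (n - 4)) ∧
        ∀ b : WittBasis B (holonomySpace Γ) 2 (n - 4),
          ∀ i, ∃ (c : ℝ) (u : Fin 2 → ℝ) (w : Fin (n - 4) → ℝ),
            b.linMatrix (γ i) = upperRightBlock !![0, c; -c, 0] ∧
            b.transCoord (γ i) = Sum.elim u (Sum.elim w 0)) ∧
      -- (3) in any Witt basis with respect to `U_Γ`
      (∀ (k m : ℕ) (b : WittBasis B (holonomySpace Γ) k m) (l : Fin N → ℝ),
        (∑ i, l i • b.compW (γ i) = 0 → ∑ i, l i • b.blockC (γ i) = 0) ∧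
        (∑ i, l i • b.blockC (γ i) = 0 ↔ ∑ i, l i • linA (γ i) = 0)) := by
  have hs := hB.symm
  have hnd := hB.eq_zero_of_forall
  have hBnd : B.Nondegenerate := ⟨hnd, fun y hy => hnd y fun x => by rw [hs, hy]⟩
  have hdim : ∀ S : Submodule ℝ (Fin n → ℝ), (∀ x ∈ S, B x x = 0) → Module.finrank ℝ S ≤ 2 :=
    hB.finrank_le_of_isotropic
  have hiso := hΓ.isometries
  have := hΓ.properlyDiscontinuous
  have := countable_of_properlyDiscontinuous Γ
  have h := hΓ.isNormalizerTransitive hs hnd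
  have hU := h.holonomySpace_isotropic hs hnd hiso hdim
  obtain ⟨N, γ, hγ, hlin⟩ := exists_generators_linearIndependent hΓ.free
    fun k₁ h₁ k₂ h₂ => h.translationPart_mul hs hnd hiso hdim h₁ h₂
  have hmem : ∀ i, γ i ∈ Γ := fun i => hγ ▸ Subgroup.subset_closure ⟨i, rfl⟩
  have hv : ∀ i, translationPart (γ i) ∈ B.orthogonal (holonomySpace Γ) :=
    fun i => h.translationPart_mem hs hnd hiso hdim (hmem i)
  have hA : ∀ i x, linA (γ i) x ∈ holonomySpace Γ :=
    fun i => linA_apply_mem_holonomySpace (hmem i)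
  have hA0 : ∀ i, ∀ x ∈ B.orthogonal (holonomySpace Γ), linA (γ i) x = 0 :=
    fun i x hx => h.linA_apply_eq_zero hs hnd hiso (hmem i) hx
  refine ⟨N, γ, ⟨hγ, hlin⟩, ?_, ?_⟩
  · rintro ⟨g, hg, hg0⟩
    have hrank : Module.finrank ℝ (holonomySpace Γ) = 2 := by
      refine le_antisymm (hdim _ fun x hx => hU x hx x hx) ?_
      rw [h.holonomySpace_eq_range hs hnd hiso hdim hg hg0]
      exact two_le_finrank_range_of_skew hs hnd (h.linA_skew hs hiso hg) hg0
    refine ⟨nonempty_wittBasis hBnd hs hU hrank (by rw [Module.finrank_fin_fun]; omega),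
      fun b i => ⟨b.blockC (γ i) 0 1, fun j => b.transCoord (γ i) (Sum.inl j),
        b.compW (γ i), ?_, ?_⟩⟩
    · have hC := b.blockC_skew hs (h.linA_skew hs hiso (hmem i)) (hA i)
      rw [b.linMatrix_eq hU (hA i) (hA0 i)]
      congr 1
      have h00 := hC 0 0
      have h11 := hC 1 1
      ext p q
      fin_cases p <;> fin_cases q <;> simp
      · linarith
      · exact hC 1 0
      · linarith
    · ext j
      rcases j with j | j | j
      · rfl
      · rfl
      · exact b.repr_inr_inr_of_mem_orthogonal (hv i) j
  · intro k m b l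
    have hTU : ∀ x, (∑ i, l i • linA (γ i)) x ∈ holonomySpace Γ := fun x => by
      rw [LinearMap.sum_apply]
      exact sum_mem fun i _ => Submodule.smul_mem _ _ (hA i x)
    have hT0 : ∀ x ∈ B.orthogonal (holonomySpace Γ), (∑ i, l i • linA (γ i)) x = 0 :=
      fun x hx => by
        rw [LinearMap.sum_apply]
        exact Finset.sum_eq_zero fun i _ => by rw [LinearMap.smul_apply, hA0 i x hx, smul_zero]
    have hC : ∑ i, l i • linA (γ i) = 0 → ∑ i, l i • b.blockC (γ i) = 0 := fun h0 => by
      ext p q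
      rw [b.sum_smul_blockC_apply, h0]
      simp
    refine ⟨fun hw => hC (h.sum_smul_linA_eq_zero hs hnd hiso hdim hmem l ?_), fun h0 => ?_, hC⟩
    -- The `u_j*`-coordinates of the `v_i` vanish, so `∑ λ_i w_i = 0` puts `∑ λ_i v_i` in `U_Γ`.
    · refine b.mem_of_repr_inr fun j => ?_
      rcases j with j | j
      · rw [← b.sum_smul_compW_apply, hw]
        rfl
      · exact b.repr_inr_inr_of_mem_orthogonal
          (sum_mem fun i _ => Submodule.smul_mem _ _ (hv i)) j
    · refine b.eq_zero_of_repr_eq_zero hU hTU hT0 fun p q => ?_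
      rw [← b.sum_smul_blockC_apply, h0]
      rfl
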